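/- Fix integers $n_a,n_b,\tilde n_a,\tilde n_b,T\ge 0$ with $n_b+\tilde n_b\le n_a+\tilde n_a$ (for instance $n_b<n_a$ and $\tilde n_b<\tilde n_a$), recorded data $\hat u=(\hat u_t)_{t=-n_b+1}^{T-1}$, $\hat y=(\hat y_t)_{t=-n_a+1}^{T}$, and noise bounds $\epsilon_u,\epsilon_y\in\mathbb R$. Let $\bar{\mathcal P}$ be the set of all $x=(a,b,\Delta u,\Delta y)$ with $a\in\mathbb R^{n_a}$, $b\in\mathbb R^{n_b}$, $\Delta u=(\Delta u_t)_{t=-n_b+1}^{T-1}$, $\Delta y=(\Delta y_t)_{t=-n_a+1}^{T}$ satisfying $$\epsilon_u\pm\Delta u_t\ge 0,\qquad \epsilon_y\pm\Delta y_t\ge 0\qquad\text{for all } t,$$ $$\hat y_t+\sum_{i=1}^{n_a}a_i\hat y_{t-i}-\sum_{i=1}^{n_b}b_i\hat u_{t-i}-\sum_{i=1}^{n_a}a_i\Delta y_{t-i}+\sum_{i=1}^{n_b}b_i\Delta u_{t-i}-\Delta y_t=0,\qquad t=1,\dots,T.$$ Denote by $g_k\ge 0$ these inequalities and by $h_t=0$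 these equations. Let $\Sigma[\bar{\mathcal P}]$ be the set of polynomials $\sigma_0+\sum_k\sigma_kg_k+\sum_t\phi_th_t$ in $x$ with $\sigma_0,\sigma_k$ sums of squares of polynomials and $\phi_t$ arbitrary polynomials, and let $\Sigma[\bar{\mathcal P}]_{\le 2d}$ be the set of those that have such a representation with $\sigma_0$, all $\sigma_kg_k$ and all $\phi_th_t$ of degree at most $2d$. Call $\bar{\mathcal P}$ Archimedean if $R-\|x\|_2^2\in\Sigma[\bar{\mathcal P}]$ for some $R>0$. For a compensator $(\tilde a,\tilde b)\in\mathbb R^{\tilde n_a}\times\mathbb R^{\tilde n_b}$ and $i=1,\dots,n_{cl}:=n_a+\tilde n_a$ let $a^{cl}_i(a,b)$ be the coefficient of $\lambda^i$ in $$\Bigl(1+\sum_{j=1}^{n_a}a_j\lambda^j\Bigr)\Bigl(1+\sum_{j=1}^{\tilde n_a}\tilde a_j\lambda^j\Bigr)+\Bigl(\sum_{j=1}^{n_b}b_j\lambda^j\Bigr)\Bigl(\sum_{j=1}^{\tilde n_b}\tilde b_j\lambda^j\Bigr)-1 .$$ Let $$\gamma^*=\inf\Bigl\{\gamma\in\mathbb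 R:\ \exists(\tilde a,\tilde b)\ \ \forall(a,b,\Delta u,\Delta y)\in\bar{\mathcal P}:\ \sum_{i=1}^{n_{cl}}|a_i^{cl}(a,b)|\le\gamma\Bigr\}$$ be the optimal value of the superstabilization problem. For $d\in\mathbb N$ let $\gamma_d^*$ be the infimum of all $\gamma\in\mathbb R$ for which there exist $(\tilde a,\tilde b)$ and polynomials $m_1,\dots,m_{n_{cl}}\in\mathbb R[a,b]$ of degree at most $2d$ with $$\gamma-\sum_{i=1}^{n_{cl}}m_i\in\Sigma[\bar{\mathcal P}]_{\le 2d},\qquad m_i-a_i^{cl}\in\Sigma[\bar{\mathcal P}]_{\le 2d},\qquad m_i+a_i^{cl}\in\Sigma[\bar{\mathcal P}]_{\le 2d}\qquad(i=1,\dots,n_{cl}).$$ Infima are taken in $[-\infty,+\infty]$, with $\inf\emptyset=+\infty$. **Theorem.** If $\bar{\mathcal P}$ is Archimedean, then $\gamma_d^*\ge\gamma_{d+1}^*\ge\gamma^*$ for all $d\in\mathbb N$, and $\lim_{d\to\infty}\gamma_d^*=\gamma^*$ in $[-\infty,+\infty]$. -/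

import Mathlib

/-! ### Sums of squares and Putinar certificates -/

/-- `p` has a Putinar certificate `σ₀ + ∑ σ_i g_i + ∑ φ_j h_j` (`σ₀`, `σ_i` sums of squares, `φ_j`
arbitrary polynomials) for the description `g_i ≥ 0`, `h_j = 0`. -/
def IsWSOS {V ι κ : Type} [Fintype ι] [Fintype κ] (g : ι → MvPolynomial V ℝ)
    (h : κ → MvPolynomial V ℝ) (p : MvPolynomial V ℝ) : Prop :=
  ∃ (σ₀ : MvPolynomial V ℝ) (σ : ι → MvPolynomial V ℝ) (φ : κ → MvPolynomial V ℝ),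
    IsSumSq σ₀ ∧ (∀ i, IsSumSq (σ i)) ∧
    p = σ₀ + ∑ i, σ i * g i + ∑ j, φ j * h j

/-- The truncated version of `IsWSOS`: every term of the certificate has degree at most `k`. -/
def IsWSOSLe {V ι κ : Type} [Fintype ι] [Fintype κ] (g : ι → MvPolynomial V ℝ)
    (h : κ → MvPolynomial V ℝ) (k : ℕ) (p : MvPolynomial V ℝ) : Prop :=
  ∃ (σ₀ : MvPolynomial V ℝ) (σ : ι → MvPolynomial V ℝ) (φ : κ → MvPolynomial V ℝ),
    IsSumSq σ₀ ∧ (∀ i, IsSumSq (σ i)) ∧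
    σ₀.totalDegree ≤ k ∧ (∀ i, (σ i * g i).totalDegree ≤ k) ∧
    (∀ j, (φ j * h j).totalDegree ≤ k) ∧
    p = σ₀ + ∑ i, σ i * g i + ∑ j, φ j * h j

/-- The Archimedean condition: `R - ‖x‖₂²` has a Putinar certificate for some `R > 0`. -/
def IsArchimedeanDescription {V ι κ : Type} [Fintype V] [Fintype ι] [Fintype κ]
    (g : ι → MvPolynomial V ℝ) (h : κ → MvPolynomial V ℝ) : Prop :=
  ∃ R : ℝ, 0 < R ∧ IsWSOS g h (MvPolynomial.C R - ∑ v, MvPolynomial.X v ^ 2)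

/-! ### Closed-loop coefficients -/

/-- The polynomial `∑_{i=1}^n c_i λ^i` in the lag variable; `c_i` is stored as `c (i - 1)`. -/
noncomputable def lagPoly {R : Type} [CommRing R] {n : ℕ} (c : Fin n → R) : Polynomial R :=
  ∑ i : Fin n, Polynomial.C (c i) * Polynomial.X ^ ((i : ℕ) + 1)

/-- The polynomial `(1 + A)(1 + Ã) + B B̃ - 1` for a plant `(a, b)` and a compensator `(ca, cb)`. -/
noncomputable def closedLoopPoly {R : Type} [CommRing R] {na nb ma mb : ℕ}
    (a : Fin na → R) (b : Fin nb → R) (ca : Fin ma → R) (cb : Fin mb → R) : Polynomial R :=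
  (1 + lagPoly a) * (1 + lagPoly ca) + lagPoly b * lagPoly cb - 1

/-- The closed-loop parameters `a^cl_i`, `i = 1, …, na + ma` (stored at `i - 1`): the coefficients
of `λ^i` in `closedLoopPoly`. -/
noncomputable def closedLoopCoeff {R : Type} [CommRing R] {na nb ma mb : ℕ}
    (a : Fin na → R) (b : Fin nb → R) (ca : Fin ma → R) (cb : Fin mb → R)
    (i : Fin (na + ma)) : R :=
  (closedLoopPoly a b ca cb).coeff ((i : ℕ) + 1)

/-! ### Noisy data and the consistency set -/

/-- The times `t = -nb + 1, …, T - 1` at which the input is recorded. -/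
abbrev InputTime (nb T : ℕ) : Type := ↥(Finset.Icc (1 - (nb : ℤ)) ((T : ℤ) - 1))

/-- The times `t = -na + 1, …, T` at which the output is recorded. -/
abbrev OutputTime (na T : ℕ) : Type := ↥(Finset.Icc (1 - (na : ℤ)) (T : ℤ))

/-- The input time `t - i`; the arguments are `t - 1` and `i - 1`. -/
def inputLag {nb T : ℕ} (t : Fin T) (i : Fin nb) : InputTime nb T :=
  ⟨((t : ℕ) : ℤ) - ((i : ℕ) : ℤ), by
    have := t.isLt
    have := i.isLt
    rw [Finset.mem_Icc]
    omega⟩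

/-- The output time `t - i`; the arguments are `t - 1` and `i - 1`. -/
def outputLag {na T : ℕ} (t : Fin T) (i : Fin na) : OutputTime na T :=
  ⟨((t : ℕ) : ℤ) - ((i : ℕ) : ℤ), by
    have := t.isLt
    have := i.isLt
    rw [Finset.mem_Icc]
    omega⟩

/-- The output time `t`; the argument is `t - 1`. -/
def outputNow {na T : ℕ} (t : Fin T) : OutputTime na T :=
  ⟨((t : ℕ) : ℤ) + 1, by
    have := t.isLt
    rw [Finset.mem_Icc]
    omega⟩

/-- Recorded inputs and outputs, together with the bounds on the noise. -/
structure NoisyData (na nb T : ℕ) where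
  uhat : InputTime nb T → ℝ
  yhat : OutputTime na T → ℝ
  epsU : ℝ
  epsY : ℝ

/-- The consistency set of all `(a, b, Δu, Δy)` that explain the data. -/
def consistencySet {na nb T : ℕ} (D : NoisyData na nb T) :
    Set ((Fin na → ℝ) × (Fin nb → ℝ) × (InputTime nb T → ℝ) × (OutputTime na T → ℝ)) :=
  {x | match x with
    | (a, b, du, dy) =>
      (∀ t, |du t| ≤ D.epsU) ∧ (∀ t, |dy t| ≤ D.epsY) ∧
      ∀ t : Fin T,
        0 = (D.yhat (outputNow t) + ∑ i, a i * D.yhat (outputLag t i)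
              - ∑ i, b i * D.uhat (inputLag t i))
            + (-(∑ i, a i * dy (outputLag t i)) + ∑ i, b i * du (inputLag t i))
            - dy (outputNow t)}

/-- The variables `(a, b)`. -/
abbrev PlantVar (na nb : ℕ) : Type := Fin na ⊕ Fin nb

/-- The variables `(a, b, Δu, Δy)`. -/
abbrev FullVar (na nb T : ℕ) : Type := PlantVar na nb ⊕ (InputTime nb T ⊕ OutputTime na T)

section Description

variable {na nb T : ℕ}

noncomputable def varA (i : Fin na) : MvPolynomial (FullVar na nb T) ℝ :=
  MvPolynomial.X (Sum.inl (Sum.inl i))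

noncomputable def varB (i : Fin nb) : MvPolynomial (FullVar na nb T) ℝ :=
  MvPolynomial.X (Sum.inl (Sum.inr i))

noncomputable def varDU (t : InputTime nb T) : MvPolynomial (FullVar na nb T) ℝ :=
  MvPolynomial.X (Sum.inr (Sum.inl t))

noncomputable def varDY (t : OutputTime na T) : MvPolynomial (FullVar na nb T) ℝ :=
  MvPolynomial.X (Sum.inr (Sum.inr t))

/-- The inequality constraints `ε_u ∓ Δu_t ≥ 0` and `ε_y ∓ Δy_t ≥ 0`. -/
noncomputable def ineqPoly (D : NoisyData na nb T) :
    (InputTime nb T ⊕ InputTime nb T) ⊕ (OutputTime na T ⊕ OutputTime na T) →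
      MvPolynomial (FullVar na nb T) ℝ
  | Sum.inl (Sum.inl t) => MvPolynomial.C D.epsU - varDU t
  | Sum.inl (Sum.inr t) => MvPolynomial.C D.epsU + varDU t
  | Sum.inr (Sum.inl t) => MvPolynomial.C D.epsY - varDY t
  | Sum.inr (Sum.inr t) => MvPolynomial.C D.epsY + varDY t

/-- The equality constraints: the noisy dynamics at the times `1, …, T`. -/
noncomputable def eqPoly (D : NoisyData na nb T) (t : Fin T) : MvPolynomial (FullVar na nb T) ℝ :=
  (MvPolynomial.C (D.yhat (outputNow t))
      + ∑ i, varA i * MvPolynomial.C (D.yhat (outputLag t i))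
      - ∑ i, varB i * MvPolynomial.C (D.uhat (inputLag t i)))
    + (-(∑ i, varA i * varDY (outputLag t i)) + ∑ i, varB i * varDU (inputLag t i))
    - varDY (outputNow t)

/-- The polynomials `ineqPoly`, `eqPoly` describe the consistency set. -/
theorem mem_consistencySet_iff (D : NoisyData na nb T) (a : Fin na → ℝ) (b : Fin nb → ℝ)
    (du : InputTime nb T → ℝ) (dy : OutputTime na T → ℝ) :
    (a, b, du, dy) ∈ consistencySet D ↔
      (∀ k, 0 ≤ MvPolynomial.eval (Sum.elim (Sum.elim a b) (Sum.elim du dy)) (ineqPoly D k)) ∧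
      ∀ t, MvPolynomial.eval (Sum.elim (Sum.elim a b) (Sum.elim du dy)) (eqPoly D t) = 0 := by
  simp only [consistencySet, Set.mem_ofPred_eq, Sum.forall, ineqPoly, eqPoly, varA, varB, varDU,
    varDY, map_add, map_sub, map_neg, map_sum, map_mul, MvPolynomial.eval_C, MvPolynomial.eval_X,
    Sum.elim_inl, Sum.elim_inr, abs_le]
  constructor
  · rintro ⟨hu, hy, he⟩
    exact ⟨⟨⟨fun t => by linarith [(hu t).2], fun t => by linarith [(hu t).1]⟩,
      fun t => by linarith [(hy t).2], fun t => by linarith [(hy t).1]⟩, fun t => (he t).symm⟩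
  · rintro ⟨⟨⟨h1, h2⟩, h3, h4⟩, he⟩
    exact ⟨fun t => ⟨by linarith [h2 t], by linarith [h1 t]⟩,
      fun t => ⟨by linarith [h4 t], by linarith [h3 t]⟩, fun t => (he t).symm⟩

end Description

/-! ### The superstabilization problem and its sum-of-squares restrictions -/

/-- The gains `γ` for which some compensator `(ca, cb)` achieves `‖a^cl‖₁ ≤ γ` for every plant
consistent with the data. -/
def feasibleGains {na nb T : ℕ} (D : NoisyData na nb T) (ma mb : ℕ) : Set ℝ :=
  {γ | ∃ (ca : Fin ma → ℝ) (cb : Fin mb → ℝ), ∀ a b du dy, (a, b, du, dy) ∈ consistencySet D →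
    ∑ i, |closedLoopCoeff a b ca cb i| ≤ γ}

/-- The optimal value `γ*` (`+∞` if infeasible, `-∞` if unbounded below). -/
noncomputable def optimalGain {na nb T : ℕ} (D : NoisyData na nb T) (ma mb : ℕ) : EReal :=
  sInf ((fun γ : ℝ => (γ : EReal)) '' feasibleGains D ma mb)

/-- `a^cl_i` as a polynomial in the plant variables `(a, b)`, for a fixed compensator. -/
noncomputable def closedLoopCoeffPoly (na nb : ℕ) {ma mb : ℕ} (ca : Fin ma → ℝ) (cb : Fin mb → ℝ)
    (i : Fin (na + ma)) : MvPolynomial (PlantVar na nb) ℝ :=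
  closedLoopCoeff (fun j : Fin na => MvPolynomial.X (Sum.inl j))
    (fun j : Fin nb => MvPolynomial.X (Sum.inr j))
    (fun j => MvPolynomial.C (ca j)) (fun j => MvPolynomial.C (cb j)) i

/-- `q(a, b)`, as a polynomial in `(a, b, Δu, Δy)`, has a Putinar certificate of degree at most
`2 * d` on the consistency set. -/
def PlantWSOSLe {na nb T : ℕ} (D : NoisyData na nb T) (d : ℕ)
    (q : MvPolynomial (PlantVar na nb) ℝ) : Prop :=
  IsWSOSLe (ineqPoly D) (eqPoly D) (2 * d) (MvPolynomial.rename Sum.inl q)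

/-- The gains `γ` that are feasible for the degree-`d` sum-of-squares restriction. -/
def sosFeasibleGains {na nb T : ℕ} (D : NoisyData na nb T) (ma mb d : ℕ) : Set ℝ :=
  {γ | ∃ (ca : Fin ma → ℝ) (cb : Fin mb → ℝ)
      (m : Fin (na + ma) → MvPolynomial (PlantVar na nb) ℝ),
    (∀ i, (m i).totalDegree ≤ 2 * d) ∧
    PlantWSOSLe D d (MvPolynomial.C γ - ∑ i, m i) ∧
    (∀ i, PlantWSOSLe D d (m i - closedLoopCoeffPoly na nb ca cb i)) ∧
    (∀ i, PlantWSOSLe D d (m i + closedLoopCoeffPoly na nb ca cb i))}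

/-- The optimal value `γ*_d` of the degree-`d` restriction (`+∞` if infeasible, `-∞` if unbounded
below). -/
noncomputable def sosOptimalGain {na nb T : ℕ} (D : NoisyData na nb T) (ma mb d : ℕ) : EReal :=
  sInf ((fun γ : ℝ => (γ : EReal)) '' sosFeasibleGains D ma mb d)

/-! ### Quadratic modules -/

/-! Certificates imply nonnegativity on the consistency set, so every relaxation bounds `γ*` from
above; raising the degree only admits more certificates. For convergence, fix a feasible `γ` with
its compensator. The plants lie in a compact ball, so Weierstrass gives polynomials `m i` slightly
above `|a^cl_i|`. All required inequalities then hold strictly, and Putinar's theorem certifies each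
in some finite degree; hence `γ + ε` is feasible for all large `d`
(`eventually_add_mem_sosFeasibleGains`).

Putinar's theorem (`mem_of_eval_pos`) is proved algebraically. Let `f` be positive wherever `M` is
nonnegative, and adjoin `-f` to `M`. If the result is proper, it extends to a maximal proper
quadratic module, which is total; standard parts of the variables then give a point where `M` and
`-f` are nonnegative, a contradiction. Otherwise `s * f - 1 ∈ M` for a sum of squares `s`, and
`mem_of_sumSq_mul_sub_one_mem` yields `f ∈ M`. -/

/-- A quadratic module of a commutative ring, as a set. -/
structure IsQuadraticModule {A : Type*} [CommRing A] (M : Set A) : Prop where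
  one_mem : 1 ∈ M
  add_mem : ∀ {a b}, a ∈ M → b ∈ M → a + b ∈ M
  sq_mul_mem : ∀ (a) {b}, b ∈ M → a ^ 2 * b ∈ M

/-- A set is Archimedean if every element of the ring is bounded above with respect to it. -/
def IsArchimedeanSet {A : Type*} [CommRing A] [Algebra ℝ A] (M : Set A) : Prop :=
  ∀ a : A, ∃ N : ℝ, algebraMap ℝ A N - a ∈ M

namespace IsQuadraticModule

section CommRing

variable {A : Type*} [CommRing A] {M : Set A}

theorem zero_mem (hM : IsQuadraticModule M) : 0 ∈ M := by
  simpa using hM.sq_mul_mem 0 hM.one_mem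

theorem sq_mem (hM : IsQuadraticModule M) (a : A) : a ^ 2 ∈ M := by
  simpa using hM.sq_mul_mem a hM.one_mem

theorem sumSq_mul_mem (hM : IsQuadraticModule M) {s b : A} (hs : IsSumSq s) (hb : b ∈ M) :
    s * b ∈ M := by
  induction hs with
  | zero => simpa using hM.zero_mem
  | sq_add a _ ih =>
    rw [add_mul, ← pow_two]
    exact hM.add_mem (hM.sq_mul_mem a hb) ih

theorem sumSq_mem (hM : IsQuadraticModule M) {s : A} (hs : IsSumSq s) : s ∈ M := by
  simpa using hM.sumSq_mul_mem hs hM.one_mem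

theorem sum_mem (hM : IsQuadraticModule M) {ι : Type*} (s : Finset ι) {f : ι → A}
    (hf : ∀ i ∈ s, f i ∈ M) : ∑ i ∈ s, f i ∈ M :=
  Finset.sum_induction f (· ∈ M) (fun _ _ => hM.add_mem) hM.zero_mem hf

/-- The quadratic module generated by `M` and `f`. -/
theorem adjoin (hM : IsQuadraticModule M) (f : A) :
    IsQuadraticModule {p | ∃ q ∈ M, ∃ s, IsSumSq s ∧ p = q + s * f} where
  one_mem := ⟨1, hM.one_mem, 0, .zero, by simp⟩
  add_mem := by
    rintro _ _ ⟨q, hq, s, hs, rfl⟩ ⟨q', hq', s', hs', rfl⟩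
    exact ⟨q + q', hM.add_mem hq hq', s + s', hs.add hs', by ring⟩
  sq_mul_mem := by
    rintro a _ ⟨q, hq, s, hs, rfl⟩
    exact ⟨a ^ 2 * q, hM.sq_mul_mem a hq, a * a * s, (IsSumSq.mul_self a).mul hs, by ring⟩

theorem subset_adjoin (f : A) : M ⊆ {p | ∃ q ∈ M, ∃ s, IsSumSq s ∧ p = q + s * f} :=
  fun q hq => ⟨q, hq, 0, .zero, by simp⟩

theorem mem_adjoin (hM : IsQuadraticModule M) (f : A) :
    f ∈ {p | ∃ q ∈ M, ∃ s, IsSumSq s ∧ p = q + s * f} :=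
  ⟨0, hM.zero_mem, 1 * 1, IsSumSq.mul_self 1, by ring⟩

theorem exists_maximal (hM : IsQuadraticModule M) (h : -1 ∉ M) :
    ∃ N, M ⊆ N ∧ Maximal (fun N => IsQuadraticModule N ∧ -1 ∉ N) N := by
  refine zorn_subset_nonempty {N | IsQuadraticModule N ∧ -1 ∉ N} ?_ M ⟨hM, h⟩
  intro c hc hchain ⟨N₀, hN₀⟩
  refine ⟨⋃₀ c, ⟨⟨⟨N₀, hN₀, (hc hN₀).1.one_mem⟩, ?_, ?_⟩, ?_⟩,
    fun s hs => Set.subset_sUnion_of_mem hs⟩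
  · rintro a b ⟨s, hs, ha⟩ ⟨t, ht, hb⟩
    rcases hchain.total hs ht with hst | hst
    · exact ⟨t, ht, (hc ht).1.add_mem (hst ha) hb⟩
    · exact ⟨s, hs, (hc hs).1.add_mem ha (hst hb)⟩
  · rintro a b ⟨s, hs, hb⟩
    exact ⟨s, hs, (hc hs).1.sq_mul_mem a hb⟩
  · rintro ⟨s, hs, h1⟩
    exact (hc hs).2 h1

end CommRing

/-! ### Quadratic modules in real algebras: totality, bounded elements, standard parts. -/

section Algebra

variable {A : Type*} [CommRing A] [Algebra ℝ A] {M : Set A}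

theorem algebraMap_mul_mem (hM : IsQuadraticModule M) {c : ℝ} (hc : 0 ≤ c) {b : A} (hb : b ∈ M) :
    algebraMap ℝ A c * b ∈ M := by
  have := hM.sq_mul_mem (algebraMap ℝ A (Real.sqrt c)) hb
  rwa [← map_pow, Real.sq_sqrt hc] at this

theorem algebraMap_mem (hM : IsQuadraticModule M) {c : ℝ} (hc : 0 ≤ c) :
    algebraMap ℝ A c ∈ M := by
  simpa using hM.algebraMap_mul_mem hc hM.one_mem

theorem of_algebraMap_mul_mem (hM : IsQuadraticModule M) {c : ℝ} (hc : 0 < c) {b : A}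
    (hb : algebraMap ℝ A c * b ∈ M) : b ∈ M := by
  have := hM.algebraMap_mul_mem (inv_nonneg.2 hc.le) hb
  rwa [← mul_assoc, ← map_mul, inv_mul_cancel₀ hc.ne', map_one, one_mul] at this

theorem neg_algebraMap_notMem (hM : IsQuadraticModule M) (h : -1 ∉ M) {c : ℝ} (hc : 0 < c) :
    -algebraMap ℝ A c ∉ M := fun hm =>
  h (hM.of_algebraMap_mul_mem hc (by simpa using hm))

/-- Polarization: `4a = (a + 1)² - (a - 1)²`. Thus `M ∩ -M` is an ideal. -/
theorem mul_mem_of_mem_of_neg_mem (hM : IsQuadraticModule M) {x : A} (hx : x ∈ M) (hx' : -x ∈ M)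
    (a : A) : x * a ∈ M := by
  refine hM.of_algebraMap_mul_mem (c := 4) (by norm_num) ?_
  have := hM.add_mem (hM.sq_mul_mem (a + 1) hx) (hM.sq_mul_mem (a - 1) hx')
  convert this using 1
  rw [map_ofNat]
  ring

theorem total_of_maximal (hM : Maximal (fun N : Set A => IsQuadraticModule N ∧ -1 ∉ N) M) (a : A) :
    a ∈ M ∨ -a ∈ M := by
  have hQ := hM.prop.1
  by_contra! hcon
  have key : ∀ b ∉ M, ∃ q ∈ M, ∃ s, IsSumSq s ∧ -1 = q + s * b := fun b hb => by
    by_contra hneg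
    exact hb (hM.le_of_ge ⟨hQ.adjoin b, hneg⟩ (subset_adjoin b) (hQ.mem_adjoin b))
  obtain ⟨q₁, hq₁, s₁, hs₁, h₁⟩ := key a hcon.1
  obtain ⟨q₂, hq₂, s₂, hs₂, h₂⟩ := key (-a) hcon.2
  -- Eliminating `a` from `-1 = q₁ + s₁ a = q₂ - s₂ a` puts `s₁` in the ideal `M ∩ -M`; then `s₁ a ∈
  -- M`, and the first equation gives `-1 ∈ M`.
  have hneg : -s₁ ∈ M := by
    have := hQ.add_mem (hQ.add_mem (hQ.sumSq_mul_mem hs₁ hq₂) (hQ.sumSq_mem hs₂))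
      (hQ.sumSq_mul_mem hs₂ hq₁)
    convert this using 1
    linear_combination s₂ * h₁ + s₁ * h₂
  have h := hQ.mul_mem_of_mem_of_neg_mem (hQ.sumSq_mem hs₁) hneg a
  exact hM.prop.2 (h₁ ▸ hQ.add_mem hq₁ h)

/-- `M` need not be closed under products, so `(ε + a)(ε - a)` is reached after scaling by `2ε = (ε
- a) + (ε + a)`, which leaves only squares times members. -/
theorem sq_le_of_abs_le (hM : IsQuadraticModule M) {ε : ℝ} (hε : 0 < ε) {a : A}
    (h₁ : algebraMap ℝ A ε + a ∈ M) (h₂ : algebraMap ℝ A ε - a ∈ M) :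
    algebraMap ℝ A (ε ^ 2) - a ^ 2 ∈ M := by
  refine hM.of_algebraMap_mul_mem (c := 2 * ε) (by positivity) ?_
  convert hM.add_mem (hM.sq_mul_mem (algebraMap ℝ A ε - a) h₁)
    (hM.sq_mul_mem (algebraMap ℝ A ε + a) h₂) using 1
  rw [map_mul, map_pow, map_ofNat]
  ring

/-! #### Bounded elements -/

/-- The elements that lie between two constants with respect to `M`. -/
def Bounded (M : Set A) (a : A) : Prop :=
  ∃ N : ℝ, 0 < N ∧ algebraMap ℝ A N + a ∈ M ∧ algebraMap ℝ A N - a ∈ M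

theorem Bounded.neg {a : A} (ha : Bounded M a) : Bounded M (-a) := by
  obtain ⟨N, hN, h₁, h₂⟩ := ha
  exact ⟨N, hN, by simpa [sub_eq_add_neg] using h₂, by simpa using h₁⟩

theorem Bounded.add (hM : IsQuadraticModule M) {a b : A} (ha : Bounded M a) (hb : Bounded M b) :
    Bounded M (a + b) := by
  obtain ⟨N, hN, h₁, h₂⟩ := ha
  obtain ⟨N', hN', h₁', h₂'⟩ := hb
  refine ⟨N + N', by positivity, ?_, ?_⟩
  · convert hM.add_mem h₁ h₁' using 1
    rw [map_add]
    ring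
  · convert hM.add_mem h₂ h₂' using 1
    rw [map_add]
    ring

theorem Bounded.algebraMap_mul (hM : IsQuadraticModule M) {a : A} (ha : Bounded M a) {c : ℝ}
    (hc : 0 < c) : Bounded M (algebraMap ℝ A c * a) := by
  obtain ⟨N, hN, h₁, h₂⟩ := ha
  refine ⟨c * N, by positivity, ?_, ?_⟩
  · simpa [mul_add] using hM.algebraMap_mul_mem hc.le h₁
  · simpa [mul_sub] using hM.algebraMap_mul_mem hc.le h₂

theorem Bounded.sq (hM : IsQuadraticModule M) {a : A} (ha : Bounded M a) : Bounded M (a ^ 2) := by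
  obtain ⟨N, hN, h₁, h₂⟩ := ha
  exact ⟨N ^ 2, by positivity, hM.add_mem (hM.algebraMap_mem (by positivity)) (hM.sq_mem a),
    hM.sq_le_of_abs_le hN h₁ h₂⟩

theorem Bounded.mul (hM : IsQuadraticModule M) {a b : A} (ha : Bounded M a) (hb : Bounded M b) :
    Bounded M (a * b) := by
  have := (((ha.add hM hb).sq hM).add hM ((ha.add hM hb.neg).sq hM).neg).algebraMap_mul hM
    (c := 1 / 4) (by norm_num)
  have h4 : algebraMap ℝ A (1 / 4) * 4 = 1 := by
    rw [← map_ofNat (algebraMap ℝ A), ← map_mul]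
    norm_num
  convert this using 1
  linear_combination -(a * b) * h4

theorem bounded_algebraMap (hM : IsQuadraticModule M) (c : ℝ) : Bounded M (algebraMap ℝ A c) := by
  refine ⟨|c| + 1, by positivity, ?_, ?_⟩
  · rw [← map_add]
    exact hM.algebraMap_mem (by linarith [neg_abs_le c])
  · rw [← map_sub]
    exact hM.algebraMap_mem (by linarith [le_abs_self c])

/-- Complete the square: `N + 1/4 ± a = (N - a²) + (a ± 1/2)²`. -/
theorem bounded_of_sq_le (hM : IsQuadraticModule M) {N : ℝ} (hN : 0 ≤ N) {a : A}
    (h : algebraMap ℝ A N - a ^ 2 ∈ M) : Bounded M a := by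
  have h4 : algebraMap ℝ A (1 / 2) * 2 = 1 := by
    rw [← map_ofNat (algebraMap ℝ A), ← map_mul]
    norm_num
  refine ⟨N + (1 / 2) ^ 2, by positivity, ?_, ?_⟩
  · convert hM.add_mem h (hM.sq_mem (a + algebraMap ℝ A (1 / 2))) using 1
    rw [map_add, map_pow]
    linear_combination -a * h4
  · convert hM.add_mem h (hM.sq_mem (a - algebraMap ℝ A (1 / 2))) using 1
    rw [map_add, map_pow]
    linear_combination a * h4

/-! #### Infinitesimal elements -/

/-- The elements that are smaller than every positive constant with respect to `M`. -/
def Infinitesimal (M : Set A) (a : A) : Prop :=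
  ∀ ε : ℝ, 0 < ε → algebraMap ℝ A ε + a ∈ M ∧ algebraMap ℝ A ε - a ∈ M

theorem Infinitesimal.neg {a : A} (ha : Infinitesimal M a) : Infinitesimal M (-a) :=
  fun ε hε => ⟨by simpa [sub_eq_add_neg] using (ha ε hε).2, by simpa using (ha ε hε).1⟩

theorem Infinitesimal.add (hM : IsQuadraticModule M) {a b : A} (ha : Infinitesimal M a)
    (hb : Infinitesimal M b) : Infinitesimal M (a + b) := fun ε hε => by
  have e : algebraMap ℝ A ε = algebraMap ℝ A (ε / 2) + algebraMap ℝ A (ε / 2) := by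
    rw [← map_add, add_halves]
  constructor
  · convert hM.add_mem (ha _ (half_pos hε)).1 (hb _ (half_pos hε)).1 using 1
    rw [e]
    ring
  · convert hM.add_mem (ha _ (half_pos hε)).2 (hb _ (half_pos hε)).2 using 1
    rw [e]
    ring

theorem infinitesimal_zero (hM : IsQuadraticModule M) : Infinitesimal M 0 := fun ε hε => by
  simpa using hM.algebraMap_mem hε.le

theorem Infinitesimal.algebraMap_mul (hM : IsQuadraticModule M) {a : A} (ha : Infinitesimal M a)
    (c : ℝ) : Infinitesimal M (algebraMap ℝ A c * a) := by
  have key : ∀ c : ℝ, 0 < c → Infinitesimal M (algebraMap ℝ A c * a) := fun c hc ε hε => by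
    have e : algebraMap ℝ A ε = algebraMap ℝ A c * algebraMap ℝ A (ε / c) := by
      rw [← map_mul, mul_div_cancel₀ _ hc.ne']
    rw [e, ← mul_add, ← mul_sub]
    exact ⟨hM.algebraMap_mul_mem hc.le (ha _ (by positivity)).1,
      hM.algebraMap_mul_mem hc.le (ha _ (by positivity)).2⟩
  rcases lt_trichotomy c 0 with hc | rfl | hc
  · simpa using (key (-c) (by linarith)).neg
  · simpa using hM.infinitesimal_zero
  · exact key c hc

theorem Infinitesimal.sq (hM : IsQuadraticModule M) {a : A} (ha : Infinitesimal M a) :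
    Infinitesimal M (a ^ 2) := fun ε hε => by
  refine ⟨hM.add_mem (hM.algebraMap_mem hε.le) (hM.sq_mem a), ?_⟩
  have hs := Real.sqrt_pos.2 hε
  have := hM.sq_le_of_abs_le hs (ha _ hs).1 (ha _ hs).2
  rwa [Real.sq_sqrt hε.le] at this

theorem Infinitesimal.mul (hM : IsQuadraticModule M) {a b : A} (ha : Infinitesimal M a)
    (hb : Infinitesimal M b) : Infinitesimal M (a * b) := by
  have := (((ha.add hM hb).sq hM).add hM ((ha.add hM hb.neg).sq hM).neg).algebraMap_mul hM (1 / 4)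
  have h4 : algebraMap ℝ A (1 / 4) * 4 = 1 := by
    rw [← map_ofNat (algebraMap ℝ A), ← map_mul]
    norm_num
  convert this using 1
  linear_combination -(a * b) * h4

/-- The standard part of an element, for a total Archimedean quadratic module. -/
theorem exists_infinitesimal_sub (hM : IsQuadraticModule M) (h1 : -1 ∉ M)
    (htot : ∀ a, a ∈ M ∨ -a ∈ M) (harch : IsArchimedeanSet M) (a : A) :
    ∃ c : ℝ, Infinitesimal M (a - algebraMap ℝ A c) := by
  -- The standard part is the supremum of the constants below `a`; totality turns failure of a lower
  -- bound into an upper bound.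
  set S : Set ℝ := {r | a - algebraMap ℝ A r ∈ M} with hS
  have hne : S.Nonempty := by
    obtain ⟨N, hN⟩ := harch (-a)
    refine ⟨-N, ?_⟩
    simpa [hS, add_comm] using hN
  have hbdd : BddAbove S := by
    obtain ⟨N, hN⟩ := harch a
    refine ⟨N, fun r hr => ?_⟩
    by_contra! hlt
    refine hM.neg_algebraMap_notMem h1 (sub_pos.2 hlt) ?_
    convert hM.add_mem hN hr using 1
    rw [map_sub]
    ring
  refine ⟨sSup S, fun ε hε => ⟨?_, ?_⟩⟩
  · obtain ⟨r, hr, hlt⟩ := exists_lt_of_lt_csSup hne (sub_lt_self (sSup S) hε)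
    convert hM.add_mem hr (hM.algebraMap_mem (c := r - (sSup S - ε)) (by linarith)) using 1
    simp only [map_sub]
    ring
  · have : sSup S + ε ∉ S := fun h => by linarith [le_csSup hbdd h]
    have := (htot (a - algebraMap ℝ A (sSup S + ε))).resolve_left this
    convert this using 1
    rw [map_add]
    ring

/-- If `t * f - 1` lies in an Archimedean quadratic module for a sum of squares `t`, then so
does `f`. -/
theorem mem_of_sumSq_mul_sub_one_mem (hM : IsQuadraticModule M) (harch : IsArchimedeanSet M)
    {t f : A} (ht : IsSumSq t) (h : t * f - 1 ∈ M) : f ∈ M := by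
  obtain ⟨N₁, hN₁⟩ := harch t
  obtain ⟨N₂, hN₂⟩ := harch (t ^ 2 * f + 1)
  obtain ⟨N₃, hN₃⟩ := harch (-f)
  obtain ⟨k, hk, hk₁, hk₂⟩ : ∃ k : ℝ, 0 < k ∧ N₁ ≤ 2 * k ∧ N₂ ≤ 2 * k :=
    ⟨|N₁| + |N₂| + 1, by positivity, by linarith [le_abs_self N₁, abs_nonneg N₁, abs_nonneg N₂],
      by linarith [le_abs_self N₂, abs_nonneg N₁, abs_nonneg N₂]⟩
  have mono : ∀ {N N' : ℝ} {a : A}, N ≤ N' → algebraMap ℝ A N - a ∈ M →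
      algebraMap ℝ A N' - a ∈ M := fun {N N' a} hle ha => by
    convert hM.add_mem ha (hM.algebraMap_mem (sub_nonneg.2 hle)) using 1
    rw [map_sub]
    ring
  replace hN₁ := mono hk₁ hN₁
  replace hN₂ := mono hk₂ hN₂
  -- A lower bound `-r` for `f` improves by `1/k²`, since `k²(f + r) - 1` equals `(k - t)²(f + r) +
  -- 2k(tf - 1) + (2k - (t²f + 1)) + r t (2k - t)`.
  have step : ∀ r : ℝ, 0 ≤ r → f + algebraMap ℝ A r ∈ M →
      f + algebraMap ℝ A (r - (k ^ 2)⁻¹) ∈ M := fun r hr hf => by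
    refine hM.of_algebraMap_mul_mem (c := k ^ 2) (by positivity) ?_
    have e : algebraMap ℝ A (k ^ 2) * algebraMap ℝ A ((k ^ 2)⁻¹) = 1 := by
      rw [← map_mul, mul_inv_cancel₀ (by positivity), map_one]
    have h₁ := hM.sq_mul_mem (algebraMap ℝ A k - t) hf
    have h₂ := hM.algebraMap_mul_mem (c := 2 * k) (by positivity) h
    have h₃ := hM.algebraMap_mul_mem hr (hM.sumSq_mul_mem ht hN₁)
    convert hM.add_mem (hM.add_mem h₁ h₂) (hM.add_mem hN₂ h₃) using 1
    simp only [map_mul, map_pow, map_sub, map_ofNat] at e ⊢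
    linear_combination -e
  -- The step needs `0 ≤ r`, so the iteration stops once `r ≤ 0`; the `max` records this.
  have iter : ∀ n : ℕ, ∃ r : ℝ, r ≤ max 0 (|N₃| - n * (k ^ 2)⁻¹) ∧ f + algebraMap ℝ A r ∈ M := by
    intro n
    induction n with
    | zero =>
      exact ⟨|N₃|, by simp, by simpa [add_comm] using mono (le_abs_self N₃) hN₃⟩
    | succ n ih =>
      obtain ⟨r, hr, hf⟩ := ih
      have hpos : 0 < (k ^ 2)⁻¹ := by positivity
      rcases le_or_gt r 0 with h0 | h0
      · exact ⟨r, le_max_of_le_left h0, hf⟩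
      · refine ⟨_, ?_, step r h0.le hf⟩
        rcases le_max_iff.1 hr with h' | h'
        · linarith
        · refine le_max_of_le_right ?_
          push_cast
          linarith
  obtain ⟨n, hn⟩ := exists_nat_gt (|N₃| / (k ^ 2)⁻¹)
  obtain ⟨r, hr, hf⟩ := iter n
  rw [div_lt_iff₀ (by positivity)] at hn
  rw [max_eq_left (by linarith)] at hr
  convert hM.add_mem hf (hM.algebraMap_mem (neg_nonneg.2 hr)) using 1
  rw [map_neg]
  ring

end Algebra

/-! ### Points from maximal quadratic modules, and Putinar's theorem. -/

section MvPolynomial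

open MvPolynomial

variable {V : Type*} {M : Set (MvPolynomial V ℝ)}

/-- Bounded elements form a subalgebra, so generators suffice. -/
theorem isArchimedeanSet_of_bounded (hM : IsQuadraticModule M)
    (hX : ∀ v, Bounded M (X v : MvPolynomial V ℝ)) : IsArchimedeanSet M := by
  intro p
  have : Bounded M p := by
    induction p using MvPolynomial.induction_on with
    | C c => exact hM.bounded_algebraMap c
    | add p q hp hq => exact hp.add hM hq
    | mul_X p v hp => exact hp.mul hM (hX v)
  obtain ⟨N, -, -, h⟩ := this
  exact ⟨N, h⟩

/-- A proper Archimedean quadratic module is nonnegative at some point. -/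
theorem exists_eval_nonneg (hM : IsQuadraticModule M) (h1 : -1 ∉ M) (harch : IsArchimedeanSet M) :
    ∃ x : V → ℝ, ∀ p ∈ M, 0 ≤ eval x p := by
  obtain ⟨N, hMN, hN⟩ := hM.exists_maximal h1
  have hQ := hN.prop.1
  choose x hx using fun v => hQ.exists_infinitesimal_sub hN.prop.2 (total_of_maximal hN)
    (fun a => (harch a).imp fun _ h => hMN h) (X v)
  -- Taking standard parts is evaluation at the point `x` of standard parts of the variables.
  have key : ∀ p, Infinitesimal N (p - algebraMap ℝ (MvPolynomial V ℝ) (eval x p)) := fun p => by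
    induction p using MvPolynomial.induction_on with
    | C c => simpa [algebraMap_eq] using hQ.infinitesimal_zero
    | add p q hp hq =>
      convert hp.add hQ hq using 1
      simp only [map_add]
      ring
    | mul_X p v hp =>
      convert ((hp.mul hQ (hx v)).add hQ ((hx v).algebraMap_mul hQ (eval x p))).add hQ
        (hp.algebraMap_mul hQ (x v)) using 1
      simp only [map_mul, eval_X]
      ring
  refine ⟨x, fun p hp => ?_⟩
  by_contra! hneg
  -- With `c = -p(x)/2 > 0`, the sum `(c - (p - p(x))) + p` is the negative constant `-c`.
  have h := hQ.add_mem (key p (-eval x p / 2) (by linarith)).2 (hMN hp)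
  refine hQ.neg_algebraMap_notMem hN.prop.2 (c := -eval x p / 2) (by linarith) ?_
  convert h using 1
  have e : eval x p = -(-eval x p / 2) - (-eval x p / 2) := by ring
  generalize -eval x p / 2 = c at *
  rw [e]
  simp only [map_sub, map_neg]
  ring

/-- **Putinar's Positivstellensatz** for an Archimedean quadratic module. -/
theorem mem_of_eval_pos (hM : IsQuadraticModule M) (harch : IsArchimedeanSet M)
    {f : MvPolynomial V ℝ} (hf : ∀ x, (∀ p ∈ M, 0 ≤ eval x p) → 0 < eval x f) : f ∈ M := by
  by_cases h : -1 ∈ {p | ∃ q ∈ M, ∃ s, IsSumSq s ∧ p = q + s * -f}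
  · obtain ⟨q, hq, s, hs, e⟩ := h
    refine hM.mem_of_sumSq_mul_sub_one_mem harch hs ?_
    convert hq using 1
    linear_combination e
  · exfalso
    obtain ⟨x, hx⟩ := (hM.adjoin (-f)).exists_eval_nonneg h
      fun a => (harch a).imp fun _ h => subset_adjoin _ h
    have h₁ := hx _ (hM.mem_adjoin (-f))
    have h₂ := hf x fun p hp => hx p (subset_adjoin _ hp)
    rw [map_neg] at h₁
    linarith

end MvPolynomial

end IsQuadraticModule

/-! ### Putinar certificates -/

section Certificates

open MvPolynomial

variable {V ι κ : Type} [Fintype ι] [Fintype κ] {g : ι → MvPolynomial V ℝ}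
  {h : κ → MvPolynomial V ℝ}

theorem isQuadraticModule_isWSOS (g : ι → MvPolynomial V ℝ) (h : κ → MvPolynomial V ℝ) :
    IsQuadraticModule {p | IsWSOS g h p} where
  one_mem := ⟨1, 0, 0, by simp, fun _ => .zero,
    by simp⟩
  add_mem := by
    rintro _ _ ⟨s, σ, φ, hs, hσ, rfl⟩ ⟨s', σ', φ', hs', hσ', rfl⟩
    refine ⟨s + s', σ + σ', φ + φ', hs.add hs', fun i => (hσ i).add (hσ' i), ?_⟩
    simp only [Pi.add_apply, add_mul, Finset.sum_add_distrib]
    ring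
  sq_mul_mem := by
    rintro a _ ⟨s, σ, φ, hs, hσ, rfl⟩
    have ha : IsSumSq (a ^ 2) := by
      rw [pow_two]
      exact .mul_self a
    refine ⟨a ^ 2 * s, fun i => a ^ 2 * σ i, fun j => a ^ 2 * φ j, ha.mul hs,
      fun i => ha.mul (hσ i), ?_⟩
    simp only [mul_add, Finset.mul_sum, mul_assoc]

theorem IsWSOS.eval_nonneg {p : MvPolynomial V ℝ} (hp : IsWSOS g h p) {x : V → ℝ}
    (hg : ∀ i, 0 ≤ eval x (g i)) (hh : ∀ j, eval x (h j) = 0) : 0 ≤ eval x p := by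
  obtain ⟨s, σ, φ, hs, hσ, rfl⟩ := hp
  have hsq : ∀ {q : MvPolynomial V ℝ}, IsSumSq q → 0 ≤ eval x q := fun hq => by
    induction hq with
    | zero => simp
    | sq_add a _ ih =>
      rw [map_add, map_mul]
      exact add_nonneg (mul_self_nonneg _) ih
  simp only [map_add, map_sum, map_mul, hh, mul_zero, Finset.sum_const_zero, add_zero]
  exact add_nonneg (hsq hs) (Finset.sum_nonneg fun i _ => mul_nonneg (hsq (hσ i)) (hg i))

theorem isWSOS_ineq (g : ι → MvPolynomial V ℝ) (h : κ → MvPolynomial V ℝ) (i : ι) :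
    IsWSOS g h (g i) := by
  classical
  refine ⟨0, Pi.single i 1, 0, .zero, fun k => ?_, ?_⟩
  · rcases eq_or_ne k i with rfl | hk
    · simp
    · simp [hk]
  · simp [Pi.single_apply]

theorem isWSOS_mul_eq (g : ι → MvPolynomial V ℝ) (h : κ → MvPolynomial V ℝ) (j : κ)
    (c : MvPolynomial V ℝ) : IsWSOS g h (c * h j) := by
  classical
  exact ⟨0, 0, Pi.single j c, .zero, fun _ => .zero, by simp [Pi.single_apply]⟩

/-- Adding the squares of the other variables to `R - ‖x‖²` gives `R - X v ^ 2`, so every variable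
is bounded. -/
theorem IsArchimedeanDescription.isArchimedeanSet [Fintype V]
    (harch : IsArchimedeanDescription g h) : IsArchimedeanSet {p | IsWSOS g h p} := by
  classical
  have hQ := isQuadraticModule_isWSOS g h
  obtain ⟨R, hR, hmem⟩ := harch
  refine hQ.isArchimedeanSet_of_bounded fun v => hQ.bounded_of_sq_le hR.le ?_
  convert hQ.add_mem (b := ∑ w ∈ Finset.univ.erase v, X w ^ 2) hmem
    (hQ.sum_mem _ fun w _ => hQ.sq_mem (X w)) using 1
  rw [← Finset.add_sum_erase _ _ (Finset.mem_univ v), algebraMap_eq]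
  ring

/-- **Putinar's Positivstellensatz**. -/
theorem isWSOS_of_eval_pos [Fintype V] (harch : IsArchimedeanDescription g h)
    {f : MvPolynomial V ℝ}
    (hf : ∀ x, (∀ i, 0 ≤ eval x (g i)) → (∀ j, eval x (h j) = 0) → 0 < eval x f) :
    IsWSOS g h f := by
  refine (isQuadraticModule_isWSOS g h).mem_of_eval_pos harch.isArchimedeanSet fun x hx =>
    hf x (fun i => hx _ (isWSOS_ineq g h i)) fun j => le_antisymm ?_ ?_
  · simpa using hx _ (isWSOS_mul_eq g h j (-1))
  · simpa using hx _ (isWSOS_mul_eq g h j 1)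

theorem IsWSOSLe.isWSOS {k : ℕ} {p : MvPolynomial V ℝ} (hp : IsWSOSLe g h k p) :
    IsWSOS g h p := by
  obtain ⟨s, σ, φ, hs, hσ, -, -, -, e⟩ := hp
  exact ⟨s, σ, φ, hs, hσ, e⟩

theorem IsWSOSLe.mono {k l : ℕ} (hkl : k ≤ l) {p : MvPolynomial V ℝ} (hp : IsWSOSLe g h k p) :
    IsWSOSLe g h l p := by
  obtain ⟨s, σ, φ, hs, hσ, h₁, h₂, h₃, e⟩ := hp
  exact ⟨s, σ, φ, hs, hσ, h₁.trans hkl, fun i => (h₂ i).trans hkl, fun j => (h₃ j).trans hkl, e⟩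

theorem IsWSOS.eventually_isWSOSLe {p : MvPolynomial V ℝ} (hp : IsWSOS g h p) :
    ∀ᶠ k in Filter.atTop, IsWSOSLe g h k p := by
  obtain ⟨s, σ, φ, hs, hσ, e⟩ := hp
  filter_upwards [Filter.eventually_ge_atTop s.totalDegree,
    Filter.eventually_all.2 fun i => Filter.eventually_ge_atTop (σ i * g i).totalDegree,
    Filter.eventually_all.2 fun j => Filter.eventually_ge_atTop (φ j * h j).totalDegree]
    with k h₁ h₂ h₃
  exact ⟨s, σ, φ, hs, hσ, h₁, h₂, h₃, e⟩

end Certificates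

/-- Polynomials are uniformly dense in the continuous functions on a compact set. -/
theorem exists_mvPolynomial_abs_sub_lt {V : Type*} {K : Set (V → ℝ)} (hK : IsCompact K)
    {f : (V → ℝ) → ℝ} (hf : Continuous f) {ε : ℝ} (hε : 0 < ε) :
    ∃ p : MvPolynomial V ℝ, ∀ x ∈ K, |MvPolynomial.eval x p - f x| < ε := by
  have : CompactSpace K := isCompact_iff_compactSpace.1 hK
  -- Stone–Weierstrass is applied to the range of `aeval coord`, the polynomial functions on `K`.
  let coord : V → C(K, ℝ) := fun v =>
    ⟨fun x => x.1 v, (continuous_apply v).comp continuous_subtype_val⟩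
  have heval : ∀ (p : MvPolynomial V ℝ) (x : K),
      MvPolynomial.aeval coord p x = MvPolynomial.eval x.1 p := fun p x => by
    induction p using MvPolynomial.induction_on with
    | C c => simp
    | add p q hp hq => simp [hp, hq]
    | mul_X p v hp => simp [hp, coord]
  have hsep : (MvPolynomial.aeval (R := ℝ) coord).range.SeparatesPoints := fun x y hxy => by
    obtain ⟨v, hv⟩ := Function.ne_iff.1 (Subtype.coe_injective.ne hxy)
    exact ⟨coord v, ⟨coord v, ⟨MvPolynomial.X v, by simp⟩, rfl⟩, hv⟩
  obtain ⟨⟨_, p, rfl⟩, hp⟩ :=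
    ContinuousMap.exists_mem_subalgebra_near_continuousMap_of_separatesPoints _ hsep
      ⟨fun x : K => f x, by fun_prop⟩ ε hε
  refine ⟨p, fun x hx => ?_⟩
  have := (ContinuousMap.norm_coe_le_norm _ (⟨x, hx⟩ : K)).trans_lt hp
  simpa [heval] using this

/-! ### The hierarchy of restrictions -/

/-- Naturality in the ring: applied to evaluation, it identifies the values of the symbolic
coefficients with the real ones. -/
theorem map_closedLoopCoeff {R S : Type} [CommRing R] [CommRing S] (φ : R →+* S)
    {na nb ma mb : ℕ} (a : Fin na → R) (b : Fin nb → R) (ca : Fin ma → R) (cb : Fin mb → R)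
    (i : Fin (na + ma)) :
    φ (closedLoopCoeff a b ca cb i) =
      closedLoopCoeff (fun j => φ (a j)) (fun j => φ (b j)) (fun j => φ (ca j))
        (fun j => φ (cb j)) i := by
  simp only [closedLoopCoeff, ← Polynomial.coeff_map]
  congr 1
  simp [closedLoopPoly, lagPoly, Polynomial.map_sum]

section Hierarchy

variable {na nb T : ℕ}

theorem eval_closedLoopCoeffPoly {ma mb : ℕ} (ca : Fin ma → ℝ) (cb : Fin mb → ℝ)
    (x : PlantVar na nb → ℝ) (i : Fin (na + ma)) :
    MvPolynomial.eval x (closedLoopCoeffPoly na nb ca cb i) =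
      closedLoopCoeff (fun j => x (Sum.inl j)) (fun j => x (Sum.inr j)) ca cb i := by
  simp [closedLoopCoeffPoly, map_closedLoopCoeff]

theorem PlantWSOSLe.mono {D : NoisyData na nb T} {d e : ℕ} (hde : d ≤ e)
    {q : MvPolynomial (PlantVar na nb) ℝ} (hq : PlantWSOSLe D d q) : PlantWSOSLe D e q :=
  IsWSOSLe.mono (by omega) hq

theorem PlantWSOSLe.eval_nonneg {D : NoisyData na nb T} {d : ℕ}
    {q : MvPolynomial (PlantVar na nb) ℝ} (hq : PlantWSOSLe D d q) {a : Fin na → ℝ}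
    {b : Fin nb → ℝ} {du : InputTime nb T → ℝ} {dy : OutputTime na T → ℝ}
    (hx : (a, b, du, dy) ∈ consistencySet D) : 0 ≤ MvPolynomial.eval (Sum.elim a b) q := by
  obtain ⟨hg, hh⟩ := (mem_consistencySet_iff D a b du dy).1 hx
  simpa [MvPolynomial.eval_rename] using (IsWSOSLe.isWSOS hq).eval_nonneg hg hh

theorem sosFeasibleGains_mono (D : NoisyData na nb T) (ma mb : ℕ) :
    Monotone (sosFeasibleGains D ma mb) := by
  rintro d e hde γ ⟨ca, cb, m, h₀, h₁, h₂, h₃⟩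
  exact ⟨ca, cb, m, fun i => (h₀ i).trans (by omega), h₁.mono hde, fun i => (h₂ i).mono hde,
    fun i => (h₃ i).mono hde⟩

theorem sosFeasibleGains_subset (D : NoisyData na nb T) (ma mb d : ℕ) :
    sosFeasibleGains D ma mb d ⊆ feasibleGains D ma mb := by
  rintro γ ⟨ca, cb, m, -, h₁, h₂, h₃⟩
  refine ⟨ca, cb, fun a b du dy hx => ?_⟩
  have h := h₁.eval_nonneg hx
  rw [map_sub, MvPolynomial.eval_C, map_sum, sub_nonneg] at h
  refine (Finset.sum_le_sum fun i _ => ?_).trans h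
  have h₂ := (h₂ i).eval_nonneg hx
  have h₃ := (h₃ i).eval_nonneg hx
  rw [map_sub, eval_closedLoopCoeffPoly] at h₂
  rw [map_add, eval_closedLoopCoeffPoly] at h₃
  simp only [Sum.elim_inl, Sum.elim_inr] at h₂ h₃
  exact abs_le.2 ⟨by linarith, by linarith⟩

/-- A polynomial in the plant variables that is positive on the consistency set has certificates
of all sufficiently large degrees. -/
theorem eventually_plantWSOSLe {D : NoisyData na nb T}
    (harch : IsArchimedeanDescription (ineqPoly D) (eqPoly D))
    {q : MvPolynomial (PlantVar na nb) ℝ}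
    (hq : ∀ a b du dy, (a, b, du, dy) ∈ consistencySet D →
      0 < MvPolynomial.eval (Sum.elim a b) q) :
    ∀ᶠ d in Filter.atTop, PlantWSOSLe D d q := by
  have h : IsWSOS (ineqPoly D) (eqPoly D) (MvPolynomial.rename Sum.inl q) := by
    refine isWSOS_of_eval_pos harch fun x hg hh => ?_
    have e : x = Sum.elim (Sum.elim (fun i => x (.inl (.inl i))) (fun i => x (.inl (.inr i))))
        (Sum.elim (fun t => x (.inr (.inl t))) (fun t => x (.inr (.inr t)))) := by
      ext ((_ | _) | (_ | _)) <;> rfl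
    rw [e] at hg hh ⊢
    simpa [MvPolynomial.eval_rename] using
      hq _ _ _ _ ((mem_consistencySet_iff D _ _ _ _).2 ⟨hg, hh⟩)
  -- The degree bound is `2 * d`, so eventuality is pulled back along `d ↦ 2 * d`.
  exact (Filter.tendsto_id.const_mul_atTop' two_pos).eventually h.eventually_isWSOSLe

/-- The plants consistent with the data form a bounded set. -/
theorem exists_isCompact_plants {D : NoisyData na nb T}
    (harch : IsArchimedeanDescription (ineqPoly D) (eqPoly D)) :
    ∃ K : Set (PlantVar na nb → ℝ), IsCompact K ∧
      ∀ a b du dy, (a, b, du, dy) ∈ consistencySet D → Sum.elim a b ∈ K := by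
  obtain ⟨R, hR, h⟩ := harch
  refine ⟨Metric.closedBall 0 (Real.sqrt R), isCompact_closedBall _ _, fun a b du dy hx => ?_⟩
  obtain ⟨hg, hh⟩ := (mem_consistencySet_iff D a b du dy).1 hx
  have hle := h.eval_nonneg hg hh
  simp only [map_sub, MvPolynomial.eval_C, map_sum, map_pow, MvPolynomial.eval_X,
    sub_nonneg] at hle
  rw [mem_closedBall_zero_iff, pi_norm_le_iff_of_nonneg (Real.sqrt_nonneg R)]
  intro v
  refine Real.abs_le_sqrt (le_trans ?_ hle)
  exact Finset.single_le_sum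
    (f := fun w => (Sum.elim (Sum.elim a b) (Sum.elim du dy) w : ℝ) ^ 2)
    (fun w _ => sq_nonneg _) (Finset.mem_univ (Sum.inl v))

theorem eventually_add_mem_sosFeasibleGains {D : NoisyData na nb T}
    (harch : IsArchimedeanDescription (ineqPoly D) (eqPoly D)) {ma mb : ℕ} {γ ε : ℝ}
    (hγ : γ ∈ feasibleGains D ma mb) (hε : 0 < ε) :
    ∀ᶠ d in Filter.atTop, γ + ε ∈ sosFeasibleGains D ma mb d := by
  obtain ⟨ca, cb, hγ⟩ := hγ
  obtain ⟨K, hK, hmem⟩ := exists_isCompact_plants harch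
  -- Each `m i` may exceed `|a^cl_i|` by up to `2δ`; the `+ 1` keeps the total excess strictly below
  -- `ε`, even without coefficients.
  set δ : ℝ := ε / (2 * (na + ma : ℕ) + 1) with hδ
  have hδ₀ : 0 < δ := by positivity
  -- Approximating the target shifted up by `δ` to within `δ` keeps `m i` strictly above `|a^cl_i|`,
  -- as Putinar's theorem requires.
  choose m hm using fun i => exists_mvPolynomial_abs_sub_lt hK
    (f := fun x => |MvPolynomial.eval x (closedLoopCoeffPoly na nb ca cb i)| + δ)
    ((MvPolynomial.continuous_eval _).abs.add continuous_const) hδ₀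
  have hm' : ∀ i a b du dy, (a, b, du, dy) ∈ consistencySet D →
      |closedLoopCoeff a b ca cb i| < MvPolynomial.eval (Sum.elim a b) (m i) ∧
      MvPolynomial.eval (Sum.elim a b) (m i) < |closedLoopCoeff a b ca cb i| + 2 * δ :=
    fun i a b du dy hx => by
      have h := abs_lt.1 (hm i _ (hmem a b du dy hx))
      rw [eval_closedLoopCoeffPoly] at h
      simp only [Sum.elim_inl, Sum.elim_inr] at h
      constructor <;> linarith [h.1, h.2]
  have h₁ : ∀ᶠ d in Filter.atTop, PlantWSOSLe D d (MvPolynomial.C (γ + ε) - ∑ i, m i) := by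
    refine eventually_plantWSOSLe harch fun a b du dy hx => ?_
    rw [map_sub, MvPolynomial.eval_C, map_sum, sub_pos]
    have h := Finset.sum_le_sum fun i (_ : i ∈ Finset.univ) => (hm' i a b du dy hx).2.le
    rw [Finset.sum_add_distrib, Finset.sum_const, Finset.card_univ, Fintype.card_fin,
      nsmul_eq_mul] at h
    have e : ε = δ * (2 * (na + ma : ℕ) + 1) := by
      rw [hδ, div_mul_cancel₀ _ (by positivity)]
    linarith [hγ a b du dy hx]
  have h₂ : ∀ i, ∀ᶠ d in Filter.atTop,
      PlantWSOSLe D d (m i - closedLoopCoeffPoly na nb ca cb i) := fun i => by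
    refine eventually_plantWSOSLe harch fun a b du dy hx => ?_
    rw [map_sub, eval_closedLoopCoeffPoly]
    exact sub_pos.2 ((le_abs_self _).trans_lt (hm' i a b du dy hx).1)
  have h₃ : ∀ i, ∀ᶠ d in Filter.atTop,
      PlantWSOSLe D d (m i + closedLoopCoeffPoly na nb ca cb i) := fun i => by
    refine eventually_plantWSOSLe harch fun a b du dy hx => ?_
    rw [map_add, eval_closedLoopCoeffPoly]
    exact neg_lt_iff_pos_add.1 ((neg_le_abs _).trans_lt (hm' i a b du dy hx).1)
  filter_upwards [h₁, Filter.eventually_all.2 h₂, Filter.eventually_all.2 h₃,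
    Filter.eventually_all.2 fun i => Filter.eventually_ge_atTop (m i).totalDegree]
    with d h₁ h₂ h₃ h₀
  exact ⟨ca, cb, m, fun i => (h₀ i).trans (by omega), h₁, h₂, h₃⟩

end Hierarchy

theorem mainTheorem1 {na nb ma mb T : ℕ} (hcl : nb + mb ≤ na + ma)
    (D : NoisyData na nb T)
    (harch : IsArchimedeanDescription (ineqPoly D) (eqPoly D)) :
    Antitone (fun d : ℕ => sosOptimalGain D ma mb d) ∧
      (∀ d : ℕ, optimalGain D ma mb ≤ sosOptimalGain D ma mb d) ∧
      Filter.Tendsto (fun d : ℕ => sosOptimalGain D ma mb d) Filter.atTop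
        (nhds (optimalGain D ma mb)) := by
  have hle : ∀ d : ℕ, optimalGain D ma mb ≤ sosOptimalGain D ma mb d := fun d =>
    sInf_le_sInf (Set.image_mono (sosFeasibleGains_subset D ma mb d))
  refine ⟨fun d e hde => sInf_le_sInf (Set.image_mono (sosFeasibleGains_mono D ma mb hde)), hle,
    tendsto_order.2 ⟨fun c hc => .of_forall fun d => hc.trans_le (hle d), fun c hc => ?_⟩⟩
  obtain ⟨_, ⟨γ, hγ, rfl⟩, hlt⟩ := sInf_lt_iff.1 hc
  -- A real `γ'` strictly between `γ` and `c` supplies `ε = γ' - γ`, so infinite values of `γ*` need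
  -- no separate case.
  obtain ⟨γ', h₁, h₂⟩ := EReal.lt_iff_exists_real_btwn.1 hlt
  filter_upwards [eventually_add_mem_sosFeasibleGains harch hγ
    (sub_pos.2 (EReal.coe_lt_coe_iff.1 h₁))] with d hd
  rw [add_sub_cancel] at hd
  exact (sInf_le (Set.mem_image_of_mem _ hd)).trans_lt h₂
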